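/- Let $[n]=\{1,\dots,n\}$ and let $\binom{[n]}{3}$ denote the set of all $3$-element subsets of $[n]$. A family $\mathcal F\subset\binom{[n]}{3}$ has property $U(s,q)$ if $|F_1\cup\dots\cup F_s|\le q$ for all choices of (not necessarily distinct) $F_1,\dots,F_s\in\mathcal F$. Let $s\ge 10$ and $n\le 3s$ be integers with $n\ge 0$, and put $$\mathcal F_3:=\Big\{A\in\binom{[n]}{3}: |A\cap[2s+1]|\ge 3\Big\}.$$ Then every family $\mathcal F\subset\binom{[n]}{3}$ with property $U(s,2s+1)$ satisfies $$|\mathcal F|\le|\mathcal F_3|\le\binom{2s+1}{3}.$$ Moreover, $\mathcal F_3$ itself has property $U(s,2s+1)$, so that the bound $|\mathcal F_3|$ is attained; and if $n\ge 2s+1$, then $\mathcal F_3=\binom{[2s+1]}{3}$. -/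

import Mathlib

/-- The collection of all `k`-element subsets of `[n] = {1, …, n}`. -/
def kSubsets (n k : ℕ) : Finset (Finset ℕ) :=
  Finset.powersetCard k (Finset.Icc 1 n)

/-- Property `U(s, q)`: the union of any `s` members of the family (repetitions allowed)
has at most `q` elements. -/
def HasPropertyU (F : Finset (Finset ℕ)) (s q : ℕ) : Prop :=
  ∀ G : Fin s → Finset ℕ, (∀ i, G i ∈ F) → (Finset.univ.biUnion G).card ≤ q

/-- The family of all `k`-subsets of `[n]` that have at least `r` elements in `[p]`. -/
def familyA (p r n k : ℕ) : Finset (Finset ℕ) :=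
  (kSubsets n k).filter (fun A => r ≤ (A ∩ Finset.Icc 1 p).card)

/-! Shifting preserves size and `U(s, q)`, so the family may be taken shifted. In a shifted family
of triples a missing `{1, x, y}` forces every `a < b < c` in the family to have `b < x` or `c < y`,
which bounds its size (`IsShifted.card_le_of_notMem`). Missing triples come from coverings: one
member `T` and `s - 1` triples through `1` that together cover `[2s+2]` cannot all be present
(`HasPropertyU.exists_notMem`). If `{2, 3, 4}` is absent, every member contains `1` and the family
is small. Otherwise the covering with `T = {2, 3, 4}` yields a missing `{1, i+4, 2s+3-i}`, which
suffices except for `i = 1` and `i = s - 1`. There a second triple `T` is tested: if present, it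
gives a better covering; if absent, its absence removes enough triples. -/

/-- A family is shifted if replacing an element of a member by a smaller positive one that it does
not contain gives a member again. -/
def IsShifted (F : Finset (Finset ℕ)) : Prop :=
  ∀ A ∈ F, ∀ i j, 1 ≤ i → i < j → j ∈ A → i ∉ A → insert i (A.erase j) ∈ F

/-- The `(i, j)`-shift of a member `A` of the family `F`. -/
def shiftMember (F : Finset (Finset ℕ)) (i j : ℕ) (A : Finset ℕ) : Finset ℕ :=
  if j ∈ A ∧ i ∉ A ∧ insert i (A.erase j) ∉ F then insert i (A.erase j) else A

/-! ### Shifting -/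

theorem erase_insert_swap {A : Finset ℕ} {i j : ℕ} (hj : j ∈ A) (hi : i ∉ A) :
    insert j ((insert i (A.erase j)).erase i) = A := by
  rw [Finset.erase_insert (by simp [hi]), Finset.insert_erase hj]

theorem shiftMember_injOn (F : Finset (Finset ℕ)) (i j : ℕ) :
    Set.InjOn (shiftMember F i j) F := by
  intro A hA B hB h
  unfold shiftMember at h
  have hA' : A ∈ F := hA
  have hB' : B ∈ F := hB
  split_ifs at h with h1 h2 h2
  · rw [← erase_insert_swap h1.1 h1.2.1, h, erase_insert_swap h2.1 h2.2.1]
  · exact absurd (h ▸ hB') h1.2.2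
  · exact absurd (h ▸ hA') h2.2.2
  · exact h

theorem hasPropertyU_shift {F : Finset (Finset ℕ)} {s q : ℕ} (hU : HasPropertyU F s q)
    {i j : ℕ} (hij : i < j) : HasPropertyU (F.image (shiftMember F i j)) s q := by
  intro G hG
  choose H hHF hHG using fun l => Finset.mem_image.1 (hG l)
  by_cases hmoved : ∃ l, H l ≠ G l
  swap
  · push Not at hmoved
    obtain rfl : H = G := funext hmoved
    exact hU _ hHF
  obtain ⟨l₀, hl₀⟩ := hmoved
  have hprop : ∀ l, H l ≠ G l → j ∈ H l ∧ i ∉ H l ∧ G l = insert i ((H l).erase j) := by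
    intro l hl
    have h := hHG l
    unfold shiftMember at h
    split_ifs at h with h1
    · exact ⟨h1.1, h1.2.1, h.symm⟩
    · exact absurd h hl
  have hfix : ∀ l, H l = G l → j ∈ H l → i ∉ H l → insert i ((H l).erase j) ∈ F := by
    intro l hl hj hi
    by_contra hc
    have h := hHG l
    rw [shiftMember, if_pos ⟨hj, hi, hc⟩, ← hl] at h
    exact hi (h ▸ Finset.mem_insert_self _ _)
  have hne : i ≠ j := hij.ne
  -- If `j` survives in some `G m`, trading `H m` for a member through `i` makes the preimages cover
  -- the whole union, with `j` supplied by `H l₀`. Otherwise they cover the union with `i` replaced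
  -- by `j`, a set of equal size.
  by_cases hj : ∃ m, j ∈ G m
  · obtain ⟨m, hm⟩ := hj
    have hmG : H m = G m := by
      by_contra hc
      obtain ⟨-, -, h⟩ := hprop m hc
      rw [h] at hm
      simp [hne.symm] at hm
    -- a member containing `i` that agrees with `G m` outside `j`
    obtain ⟨M, hMF, hiM, hM⟩ : ∃ M ∈ F, i ∈ M ∧ ∀ x ∈ G m, x ≠ j → x ∈ M := by
      by_cases hi : i ∈ H m
      · exact ⟨H m, hHF m, hi, fun x hx _ => hmG ▸ hx⟩
      · exact ⟨_, hfix m hmG (hmG ▸ hm) hi, Finset.mem_insert_self _ _, fun x hx hxj => by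
          simp [hxj, hmG, hx]⟩
    have hml : l₀ ≠ m := fun h => hl₀ (h ▸ hmG)
    refine le_trans (Finset.card_le_card ?_) (hU (Function.update H m M) ?_)
    · intro x hx
      simp only [Finset.mem_biUnion, Finset.mem_univ, true_and] at hx ⊢
      obtain ⟨l, hl⟩ := hx
      by_cases hxi : x = i
      · exact ⟨m, by simp [hxi, hiM]⟩
      by_cases hxj : x = j
      · exact ⟨l₀, by rw [Function.update_of_ne hml, hxj]; exact (hprop l₀ hl₀).1⟩
      by_cases hlm : l = m
      · subst hlm
        exact ⟨l, by simpa using hM x hl hxj⟩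
      · refine ⟨l, ?_⟩
        rw [Function.update_of_ne hlm]
        by_cases hlH : H l = G l
        · rwa [hlH]
        · rw [(hprop l hlH).2.2] at hl
          simp only [Finset.mem_insert, Finset.mem_erase, hxi, false_or] at hl
          exact hl.2
    · intro l
      by_cases hlm : l = m
      · subst hlm; simpa using hMF
      · rw [Function.update_of_ne hlm]; exact hHF l
  · push Not at hj
    have hjU : j ∉ (Finset.univ.biUnion G).erase i := by simp [hj]
    have hiU : i ∈ Finset.univ.biUnion G :=
      Finset.mem_biUnion.2 ⟨l₀, Finset.mem_univ _, by
        rw [(hprop l₀ hl₀).2.2]; exact Finset.mem_insert_self _ _⟩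
    have hcard : (insert j ((Finset.univ.biUnion G).erase i)).card
        = (Finset.univ.biUnion G).card := by
      rw [Finset.card_insert_of_notMem hjU, Finset.card_erase_add_one hiU]
    rw [← hcard]
    refine le_trans (Finset.card_le_card ?_) (hU H hHF)
    intro x hx
    simp only [Finset.mem_insert, Finset.mem_erase, Finset.mem_biUnion, Finset.mem_univ,
      true_and] at hx ⊢
    rcases hx with rfl | ⟨hxi, l, hl⟩
    · exact ⟨l₀, (hprop l₀ hl₀).1⟩
    · refine ⟨l, ?_⟩
      by_cases hlH : H l = G l
      · rwa [hlH]
      · rw [(hprop l hlH).2.2] at hl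
        simp only [Finset.mem_insert, Finset.mem_erase, hxi, false_or] at hl
        exact hl.2

theorem shiftMember_mem_kSubsets {F : Finset (Finset ℕ)} {n k i j : ℕ} (hi : 1 ≤ i) (hij : i < j)
    {A : Finset ℕ} (hA : A ∈ kSubsets n k) : shiftMember F i j A ∈ kSubsets n k := by
  unfold shiftMember
  split_ifs with h
  · rw [kSubsets, Finset.mem_powersetCard] at hA ⊢
    have hjn := Finset.mem_Icc.1 (hA.1 h.1)
    refine ⟨fun x hx => ?_, ?_⟩
    · rcases Finset.mem_insert.1 hx with rfl | hx
      · exact Finset.mem_Icc.2 ⟨hi, by omega⟩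
      · exact hA.1 (Finset.mem_of_mem_erase hx)
    · rw [Finset.card_insert_of_notMem (by simp [h.2.1]), Finset.card_erase_add_one h.1, hA.2]
  · exact hA

theorem sum_shiftMember_le (F : Finset (Finset ℕ)) {i j : ℕ} (hij : i < j) (A : Finset ℕ) :
    ∑ x ∈ shiftMember F i j A, x ≤ ∑ x ∈ A, x := by
  unfold shiftMember
  split_ifs with h
  · rw [Finset.sum_insert (by simp [h.2.1]), ← Finset.add_sum_erase A _ h.1]
    omega
  · exact le_rfl

/-- Every family with property `U(s, q)` can be replaced by a shifted one of the same size. -/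
theorem exists_isShifted {F : Finset (Finset ℕ)} {n k s q : ℕ} (hF : F ⊆ kSubsets n k)
    (hU : HasPropertyU F s q) :
    ∃ F' ⊆ kSubsets n k, HasPropertyU F' s q ∧ F'.card = F.card ∧ IsShifted F' := by
  -- A shift that moves some member strictly lowers the total sum of elements.
  induction hw : ∑ A ∈ F, ∑ x ∈ A, x using Nat.strong_induction_on generalizing F with
  | _ w ih =>
    by_cases hs : IsShifted F
    · exact ⟨F, hF, hU, rfl, hs⟩
    unfold IsShifted at hs
    push Not at hs
    obtain ⟨A, hA, i, j, hi, hij, hjA, hiA, hnot⟩ := hs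
    have hcard := Finset.card_image_of_injOn (shiftMember_injOn F i j)
    obtain ⟨F', h1, h2, h3, h4⟩ := ih (∑ B ∈ F.image (shiftMember F i j), ∑ x ∈ B, x) (by
        rw [Finset.sum_image (shiftMember_injOn F i j), ← hw]
        refine Finset.sum_lt_sum (fun B _ => sum_shiftMember_le F hij B) ⟨A, hA, ?_⟩
        rw [shiftMember, if_pos ⟨hjA, hiA, hnot⟩, Finset.sum_insert (by simp [hiA]),
          ← Finset.add_sum_erase A _ hjA]
        omega)
      (fun B hB => by
        obtain ⟨C, hC, rfl⟩ := Finset.mem_image.1 hB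
        exact shiftMember_mem_kSubsets hi hij (hF hC))
      (hasPropertyU_shift hU hij) rfl
    exact ⟨F', h1, h2, h3.trans hcard, h4⟩

/-! ### Triples, coverings and counting -/

/-- Lowering the smallest entry first keeps each intermediate triple sorted, so no replacement
collides with another entry. -/
theorem IsShifted.triple_mem {F : Finset (Finset ℕ)} (hF : IsShifted F) {a b c a' b' c' : ℕ}
    (h : {a, b, c} ∈ F) (hab : a < b) (hbc : b < c) (ha' : 1 ≤ a') (hab' : a' < b')
    (hbc' : b' < c') (ha : a' ≤ a) (hb : b' ≤ b) (hc : c' ≤ c) :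
    ({a', b', c'} : Finset ℕ) ∈ F := by
  have step1 : ({a', b, c} : Finset ℕ) ∈ F := by
    rcases ha.eq_or_lt with rfl | ha
    · exact h
    · convert hF _ h a' a ha' ha (by simp) (by simp; omega) using 1
      ext x; simp only [Finset.mem_insert, Finset.mem_singleton, Finset.mem_erase]; omega
  have step2 : ({a', b', c} : Finset ℕ) ∈ F := by
    rcases hb.eq_or_lt with rfl | hb
    · exact step1
    · convert hF _ step1 b' b (by omega) hb (by simp) (by simp; omega) using 1
      ext x; simp only [Finset.mem_insert, Finset.mem_singleton, Finset.mem_erase]; omega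
  rcases hc.eq_or_lt with rfl | hc
  · exact step2
  · convert hF _ step2 c' c (by omega) hc (by simp) (by simp; omega) using 1
    ext x; simp only [Finset.mem_insert, Finset.mem_singleton, Finset.mem_erase]; omega

theorem exists_sorted_triple {n : ℕ} {A : Finset ℕ} (hA : A ∈ kSubsets n 3) :
    ∃ a b c, 1 ≤ a ∧ a < b ∧ b < c ∧ c ≤ n ∧ A = {a, b, c} := by
  obtain ⟨hsub, hcard⟩ := Finset.mem_powersetCard.1 hA
  obtain ⟨x, y, z, hxy, hxz, hyz, rfl⟩ := Finset.card_eq_three.1 hcard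
  have hx := Finset.mem_Icc.1 (hsub (show x ∈ _ by simp))
  have hy := Finset.mem_Icc.1 (hsub (show y ∈ _ by simp))
  have hz := Finset.mem_Icc.1 (hsub (show z ∈ _ by simp))
  have key : ∀ a b c, 1 ≤ a → a < b → b < c → c ≤ n →
      (∀ t, t = x ∨ t = y ∨ t = z ↔ t = a ∨ t = b ∨ t = c) →
      ∃ a b c, 1 ≤ a ∧ a < b ∧ b < c ∧ c ≤ n ∧ ({x, y, z} : Finset ℕ) = {a, b, c} :=
    fun a b c h1 h2 h3 h4 h => ⟨a, b, c, h1, h2, h3, h4, by ext t; simpa using h t⟩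
  rcases hxy.lt_or_gt with h1 | h1 <;> rcases hxz.lt_or_gt with h2 | h2 <;>
    rcases hyz.lt_or_gt with h3 | h3
  · exact key x y z hx.1 h1 h3 hz.2 (by omega)
  · exact key x z y hx.1 h2 h3 hy.2 (by omega)
  · omega
  · exact key z x y hz.1 h2 h1 hy.2 (by omega)
  · exact key y x z hy.1 h1 h2 hz.2 (by omega)
  · omega
  · exact key y z x hy.1 h3 h2 hx.2 (by omega)
  · exact key z y x hz.1 h3 h1 hx.2 (by omega)

/-- A family with `U(s, q)` cannot contain a triple `T` and `s - 1` triples `{1, u i, v i}` that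
together cover more than `q` elements. -/
theorem HasPropertyU.exists_notMem {F : Finset (Finset ℕ)} {s q : ℕ} (hU : HasPropertyU F s q)
    (hs : 0 < s) {T : Finset ℕ} (hT : T ∈ F) (u v : ℕ → ℕ)
    (hcov : ∀ y, 1 ≤ y → y ≤ q + 1 →
      y ∈ T ∨ ∃ i, 1 ≤ i ∧ i < s ∧ (y = 1 ∨ y = u i ∨ y = v i)) :
    ∃ i, 1 ≤ i ∧ i < s ∧ ({1, u i, v i} : Finset ℕ) ∉ F := by
  by_contra! hc
  have h := hU (fun i => if (i : ℕ) = 0 then T else {1, u i, v i}) (fun i => by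
    split_ifs with h0
    · exact hT
    · exact hc i (by omega) i.2)
  have hsub : Finset.Icc 1 (q + 1) ⊆ Finset.univ.biUnion
      (fun i : Fin s => if (i : ℕ) = 0 then T else {1, u i, v i}) := by
    intro y hy
    rw [Finset.mem_Icc] at hy
    rw [Finset.mem_biUnion]
    rcases hcov y hy.1 hy.2 with h | ⟨i, h1, h2, h3⟩
    · exact ⟨⟨0, hs⟩, Finset.mem_univ _, by simpa using h⟩
    · refine ⟨⟨i, h2⟩, Finset.mem_univ _, ?_⟩
      rw [if_neg (by dsimp only; omega)]
      simpa using h3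
  have := Finset.card_le_card hsub
  rw [Nat.card_Icc] at this
  omega

/-- The triples obtained by adding an element of `C` to a pair in `P`. -/
def pairsWith (P : Finset (Finset ℕ)) (C : Finset ℕ) : Finset (Finset ℕ) :=
  (P ×ˢ C).image fun x => insert x.2 x.1

theorem card_pairsWith_le (P : Finset (Finset ℕ)) (C : Finset ℕ) :
    (pairsWith P C).card ≤ P.card * C.card :=
  Finset.card_image_le.trans (Finset.card_product _ _).le

theorem triple_mem_pairsWith {P : Finset (Finset ℕ)} {C : Finset ℕ} {a b c : ℕ}
    (hP : {a, b} ∈ P) (hC : c ∈ C) : ({a, b, c} : Finset ℕ) ∈ pairsWith P C :=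
  Finset.mem_image.2 ⟨({a, b}, c), Finset.mem_product.2 ⟨hP, hC⟩, by
    ext x; simp only [Finset.mem_insert, Finset.mem_singleton]; tauto⟩

theorem triple_mem_powersetCard {l m a b c : ℕ} (ha : l ≤ a) (hab : a < b) (hbc : b < c)
    (hc : c ≤ m) : ({a, b, c} : Finset ℕ) ∈ Finset.powersetCard 3 (Finset.Icc l m) := by
  rw [Finset.mem_powersetCard]
  refine ⟨fun x hx => ?_, Finset.card_eq_three.2 ⟨a, b, c, by omega, by omega, by omega, rfl⟩⟩
  simp only [Finset.mem_insert, Finset.mem_singleton] at hx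
  rw [Finset.mem_Icc]; omega

theorem pair_mem_powersetCard {p a b : ℕ} (ha : 1 ≤ a) (hab : a < b) (hb : b ≤ p) :
    ({a, b} : Finset ℕ) ∈ Finset.powersetCard 2 (Finset.Icc 1 p) := by
  rw [Finset.mem_powersetCard]
  refine ⟨fun x hx => ?_, Finset.card_pair (by omega)⟩
  simp only [Finset.mem_insert, Finset.mem_singleton] at hx
  rw [Finset.mem_Icc]; omega

/-- If every triple of `F` has its two smallest elements in `[p]` or is contained in `[m]`, then
`F` has at most `C(m, 3) + C(p, 2) (n - m)` members. -/
theorem card_le_of_pair_or_subset {F : Finset (Finset ℕ)} {n p m : ℕ} (hF : F ⊆ kSubsets n 3)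
    (h : ∀ a b c, 1 ≤ a → a < b → b < c → {a, b, c} ∈ F → b ≤ p ∨ c ≤ m) :
    F.card ≤ m.choose 3 + p.choose 2 * (n - m) := by
  have hsub : F ⊆ Finset.powersetCard 3 (Finset.Icc 1 m) ∪
      pairsWith (Finset.powersetCard 2 (Finset.Icc 1 p)) (Finset.Icc (m + 1) n) := by
    intro A hA
    obtain ⟨a, b, c, ha, hab, hbc, hc, rfl⟩ := exists_sorted_triple (hF hA)
    rw [Finset.mem_union]
    by_cases hcm : c ≤ m
    · exact Or.inl (triple_mem_powersetCard ha hab hbc hcm)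
    · have := h a b c ha hab hbc hA
      exact Or.inr (triple_mem_pairsWith (pair_mem_powersetCard ha hab (by omega))
        (Finset.mem_Icc.2 (by omega)))
  refine (Finset.card_le_card hsub).trans ((Finset.card_union_le _ _).trans ?_)
  have := card_pairsWith_le (Finset.powersetCard 2 (Finset.Icc 1 p)) (Finset.Icc (m + 1) n)
  simp only [Finset.card_powersetCard, Nat.card_Icc, Nat.add_sub_cancel,
    Nat.add_sub_add_right] at this ⊢
  omega

/-- In a shifted family, a missing `{1, x, y}` confines every triple. -/
theorem IsShifted.card_le_of_notMem {F : Finset (Finset ℕ)} (hS : IsShifted F) {n x y : ℕ}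
    (hF : F ⊆ kSubsets n 3) (hx : 1 < x) (hxy : x < y) (h : ({1, x, y} : Finset ℕ) ∉ F) :
    F.card ≤ (y - 1).choose 3 + (x - 1).choose 2 * (n - (y - 1)) := by
  refine card_le_of_pair_or_subset hF fun a b c ha hab hbc hA => ?_
  by_contra! hc
  exact h (hS.triple_mem hA hab hbc le_rfl hx hxy ha (by omega) (by omega))

/-! ### Binomial inequalities -/

theorem two_mul_choose_two (k : ℕ) : 2 * (k + 1).choose 2 = (k + 1) * k := by
  have h := Nat.add_one_mul_choose_eq k 1
  rw [Nat.choose_one_right] at h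
  linarith

theorem six_mul_choose_three (k : ℕ) : 6 * (k + 2).choose 3 = (k + 2) * (k + 1) * k := by
  have h := Nat.add_one_mul_choose_eq (k + 1) 2
  have h2 := two_mul_choose_two k
  nlinarith

/-- With `p = u + 1` and `s = u + v + 1`, six times the difference for `n = 3s` is a polynomial in
`u, v` with nonnegative coefficients. -/
theorem choose_bound_of_three {s n p : ℕ} (hn : n ≤ 3 * s) (hp : 1 ≤ p) (hps : p ≤ s) :
    (2 * s + 2 - p).choose 3 + p.choose 2 * (n - (2 * s + 2 - p)) ≤ (2 * s + 1).choose 3 := by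
  obtain ⟨u, rfl⟩ := Nat.exists_eq_add_of_le' hp
  obtain ⟨v, rfl⟩ := Nat.exists_eq_add_of_le' hps
  have hm : 2 * (v + (u + 1)) + 2 - (u + 1) = (u + 2 * v + 1) + 2 := by omega
  have hr : 2 * (v + (u + 1)) + 1 = (2 * u + 2 * v + 1) + 2 := by omega
  rw [hm, hr]
  have hk : n - (u + 2 * v + 1 + 2) ≤ 2 * u + v := by omega
  have h1 := six_mul_choose_three (u + 2 * v + 1)
  have h2 := six_mul_choose_three (2 * u + 2 * v + 1)
  have h3 := two_mul_choose_two u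
  have h4 := Nat.mul_le_mul_left ((u + 1).choose 2) hk
  have h5 : 2 * ((u + 1).choose 2 * (2 * u + v)) = (u + 1) * u * (2 * u + v) := by
    rw [← h3]; ring
  have h6 : (u + 2 * v + 1 + 2) * (u + 2 * v + 1 + 1) * (u + 2 * v + 1)
      + 3 * ((u + 1) * u * (2 * u + v)) ≤
      (2 * u + 2 * v + 1 + 2) * (2 * u + 2 * v + 1 + 1) * (2 * u + 2 * v + 1) := by
    ring_nf
    nlinarith [Nat.zero_le (u * v), Nat.zero_le (u ^ 2 * v), Nat.zero_le (u * v ^ 2),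
      Nat.zero_le (u ^ 3), Nat.zero_le (u ^ 2)]
  omega

theorem choose_bound_of_six {s n p : ℕ} (hs : 10 ≤ s) (hn : n ≤ 3 * s) (hp : 5 ≤ p)
    (hps : p ≤ s + 1) :
    (2 * s + 5 - p).choose 3 + p.choose 2 * (n - (2 * s + 5 - p)) ≤ (2 * s + 1).choose 3 := by
  obtain ⟨u, rfl⟩ := Nat.exists_eq_add_of_le' hp
  obtain ⟨v, rfl⟩ : ∃ v, s = v + u + 4 := ⟨s - u - 4, by omega⟩
  have hm : 2 * (v + u + 4) + 5 - (u + 5) = (u + 2 * v + 6) + 2 := by omega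
  have hr : 2 * (v + u + 4) + 1 = (2 * u + 2 * v + 7) + 2 := by omega
  rw [hm, hr]
  have hk : n - (u + 2 * v + 6 + 2) ≤ 2 * u + v + 4 := by omega
  have h1 := six_mul_choose_three (u + 2 * v + 6)
  have h2 := six_mul_choose_three (2 * u + 2 * v + 7)
  have h3 := two_mul_choose_two (u + 4)
  have h4 := Nat.mul_le_mul_left ((u + 5).choose 2) hk
  have h5 : 2 * ((u + 5).choose 2 * (2 * u + v + 4)) = (u + 5) * (u + 4) * (2 * u + v + 4) := by
    rw [← h3]; ring
  have h6 : (u + 2 * v + 6 + 2) * (u + 2 * v + 6 + 1) * (u + 2 * v + 6)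
      + 3 * ((u + 5) * (u + 4) * (2 * u + v + 4)) ≤
      (2 * u + 2 * v + 7 + 2) * (2 * u + 2 * v + 7 + 1) * (2 * u + 2 * v + 7) := by
    -- Here `s ≥ 10` enters: the inequality fails for `u = v = 0`.
    have huv : 6 ≤ u + v := by omega
    zify at huv ⊢
    have hu : (0 : ℤ) ≤ u := by positivity
    have hv : (0 : ℤ) ≤ v := by positivity
    nlinarith [mul_nonneg hu hv, mul_nonneg (mul_nonneg hu hv) hu, mul_nonneg (mul_nonneg hu hv) hv,
      mul_nonneg hu (sq_nonneg ((u : ℤ) - 6)), mul_nonneg hv (sub_nonneg.2 huv),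
      mul_nonneg hu (sub_nonneg.2 huv), mul_nonneg (mul_nonneg hu hu) (sub_nonneg.2 huv)]
  omega

/-! ### The bound for shifted families -/

theorem IsShifted.card_le_choose {F : Finset (Finset ℕ)} {n s : ℕ} (hS : IsShifted F)
    (hs : 10 ≤ s) (hn : n ≤ 3 * s) (hF : F ⊆ kSubsets n 3)
    (hU : HasPropertyU F s (2 * s + 1)) : F.card ≤ (2 * s + 1).choose 3 := by
  by_cases h234 : ({2, 3, 4} : Finset ℕ) ∈ F
  swap
  · have hsub : F ⊆ pairsWith ((Finset.Icc 2 n).powersetCard 2) {1} := by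
      intro A hA
      obtain ⟨a, b, c, ha, hab, hbc, hc, rfl⟩ := exists_sorted_triple (hF hA)
      obtain rfl : a = 1 := by
        by_contra hne
        exact h234 (hS.triple_mem hA hab hbc (by omega) (by omega) (by omega) (by omega)
          (by omega) (by omega))
      have : ({1, b, c} : Finset ℕ) = {b, c, 1} := by
        ext x; simp only [Finset.mem_insert, Finset.mem_singleton]; tauto
      rw [this]
      refine triple_mem_pairsWith (Finset.mem_powersetCard.2 ⟨fun x hx => ?_,
        Finset.card_pair (by omega)⟩) (by simp)
      simp only [Finset.mem_insert, Finset.mem_singleton] at hx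
      rw [Finset.mem_Icc]; omega
    have h := (Finset.card_le_card hsub).trans (card_pairsWith_le _ _)
    rw [Finset.card_powersetCard, Nat.card_Icc, Finset.card_singleton, mul_one] at h
    have h1 : (n + 1 - 2).choose 2 ≤ (3 * s - 2 + 1).choose 2 := Nat.choose_le_choose 2 (by omega)
    have h2 := two_mul_choose_two (3 * s - 2)
    have h3 := six_mul_choose_three (2 * s - 1)
    obtain ⟨t, rfl⟩ := Nat.exists_eq_add_of_le' hs
    rw [show 3 * (t + 10) - 2 = 3 * t + 28 by omega] at h1 h2
    rw [show 2 * (t + 10) - 1 = 2 * t + 19 by omega] at h3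
    rw [show 2 * (t + 10) + 1 = 2 * t + 19 + 2 by omega]
    have h4 : 3 * ((3 * t + 28 + 1) * (3 * t + 28)) ≤
        (2 * t + 19 + 2) * (2 * t + 19 + 1) * (2 * t + 19) := by
      ring_nf; nlinarith [Nat.zero_le (t ^ 3), Nat.zero_le (t ^ 2)]
    omega
  -- As `i` runs over `1, …, s-1`, `i + 4` covers `5, …, s+3` and `2s + 3 - i` covers `s+4, …,
  -- 2s+2`.
  obtain ⟨i, hi1, his, hi⟩ := hU.exists_notMem (by omega) h234 (fun i => i + 4)
    (fun i => 2 * s + 3 - i) (fun y h1 h2 => by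
      by_cases hy1 : y = 1
      · exact Or.inr ⟨1, le_rfl, by omega, Or.inl hy1⟩
      by_cases hy4 : y ≤ 4
      · left; simp only [Finset.mem_insert, Finset.mem_singleton]; omega
      by_cases hy : y ≤ s + 3
      · exact Or.inr ⟨y - 4, by omega, by omega, by omega⟩
      · exact Or.inr ⟨2 * s + 3 - y, by omega, by omega, by omega⟩)
  have hcard := hS.card_le_of_notMem hF (by omega) (by omega) hi
  by_cases hmid : 2 ≤ i ∧ i + 2 ≤ s
  · have := choose_bound_of_six hs hn (p := i + 3) (by omega) (by omega)
    rw [show 2 * s + 5 - (i + 3) = 2 * s + 3 - i - 1 by omega] at this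
    exact hcard.trans this
  by_cases hi_one : i = 1
  · subst hi_one
    by_cases hT : ({s + 1, s + 2, s + 3} : Finset ℕ) ∈ F
    · obtain ⟨k, hk1, hks, hk⟩ := hU.exists_notMem (by omega) hT (fun i => i + 1)
        (fun i => 2 * s + 3 - i) (fun y h1 h2 => by
          by_cases hy1 : y = 1
          · exact Or.inr ⟨1, le_rfl, by omega, Or.inl hy1⟩
          by_cases hy : y ≤ s
          · exact Or.inr ⟨y - 1, by omega, by omega, by omega⟩
          by_cases hy : y ≤ s + 3
          · left; simp only [Finset.mem_insert, Finset.mem_singleton]; omega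
          · exact Or.inr ⟨2 * s + 3 - y, by omega, by omega, by omega⟩)
      have hcard := hS.card_le_of_notMem hF (by omega) (by omega) hk
      have := choose_bound_of_three hn (p := k) (by omega) (by omega)
      rw [show 2 * s + 2 - k = 2 * s + 3 - k - 1 by omega] at this
      exact hcard.trans this
    -- No member lies in `[s+1, 2s+1]`. This loss of `C(s+1, 3)` triples outweighs the at most
    -- `6(s-1)` members reaching beyond `2s+1`.
    · have hsub : F ⊆ (Finset.powersetCard 3 (Finset.Icc 1 (2 * s + 1)) \
          Finset.powersetCard 3 (Finset.Icc (s + 1) (2 * s + 1))) ∪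
          pairsWith (Finset.powersetCard 2 (Finset.Icc 1 4)) (Finset.Icc (2 * s + 2) n) := by
        intro A hA
        obtain ⟨a, b, c, ha, hab, hbc, hc, rfl⟩ := exists_sorted_triple (hF hA)
        rw [Finset.mem_union, Finset.mem_sdiff]
        by_cases hcm : c ≤ 2 * s + 1
        · refine Or.inl ⟨triple_mem_powersetCard ha hab hbc hcm, fun h => hT ?_⟩
          have := Finset.mem_Icc.1 ((Finset.mem_powersetCard.1 h).1 (Finset.mem_insert_self _ _))
          exact hS.triple_mem hA hab hbc (by omega) (by omega) (by omega) (by omega) (by omega)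
            (by omega)
        · refine Or.inr (triple_mem_pairsWith (pair_mem_powersetCard ha hab ?_)
            (Finset.mem_Icc.2 (by omega)))
          by_contra hb
          exact hi (hS.triple_mem hA hab hbc le_rfl (by omega) (by omega) ha (by omega)
            (by omega))
      have h := (Finset.card_le_card hsub).trans (Finset.card_union_le _ _)
      have h1 := card_pairsWith_le (Finset.powersetCard 2 (Finset.Icc 1 4))
        (Finset.Icc (2 * s + 2) n)
      have h2 := Finset.card_sdiff_add_card_eq_card (Finset.powersetCard_mono (n := 3)
        (Finset.Icc_subset_Icc_left (b := 2 * s + 1) (show 1 ≤ s + 1 by omega)))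
      simp only [Finset.card_powersetCard, Nat.card_Icc] at h1 h2
      rw [show 2 * s + 1 + 1 - (s + 1) = s - 1 + 2 by omega, Nat.add_sub_cancel] at h2
      have h3 := six_mul_choose_three (s - 1)
      have h4 : (4 + 1 - 1).choose 2 = 6 := rfl
      rw [h4] at h1
      have h5 : 36 * (s - 1) ≤ (s - 1 + 2) * (s - 1 + 1) * (s - 1) :=
        Nat.mul_le_mul_right _ (by nlinarith [show 9 ≤ s - 1 by omega])
      omega
  · obtain rfl : s = i + 1 := by omega
    by_cases hT : ({2, i + 3, 2 * i + 4} : Finset ℕ) ∈ F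
    · obtain ⟨k, hk1, hks, hk⟩ := hU.exists_notMem (by omega) hT (fun k => k + 2)
        (fun k => 2 * i + 4 - k) (fun y h1 h2 => by
          by_cases hy1 : y = 1
          · exact Or.inr ⟨1, le_rfl, by omega, Or.inl hy1⟩
          by_cases hyT : y = 2 ∨ y = i + 3 ∨ y = 2 * i + 4
          · left; simpa using hyT
          by_cases hy : y ≤ i + 2
          · exact Or.inr ⟨y - 2, by omega, by omega, by omega⟩
          · exact Or.inr ⟨2 * i + 4 - y, by omega, by omega, by omega⟩)
      have hcard := hS.card_le_of_notMem hF (by omega) (by omega) hk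
      have := choose_bound_of_three hn (p := k + 1) (by omega) (by omega)
      rw [show 2 * (i + 1) + 2 - (k + 1) = 2 * i + 4 - k - 1 by omega] at this
      exact hcard.trans this
    -- Missing `{1, i+4, i+5}` gives `b ≤ i + 3` once `c > i + 3`; missing `T` leaves `{1, i+3}` as
    -- the only pair with `b = i + 3` when `c ≥ 2i + 4`.
    · have hsub : F ⊆ Finset.powersetCard 3 (Finset.Icc 1 (i + 3)) ∪
          (pairsWith (Finset.powersetCard 2 (Finset.Icc 1 (i + 3)))
            (Finset.Icc (i + 4) (2 * i + 3)) ∪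
          pairsWith (insert {1, i + 3} (Finset.powersetCard 2 (Finset.Icc 1 (i + 2))))
            (Finset.Icc (2 * i + 4) n)) := by
        intro A hA
        obtain ⟨a, b, c, ha, hab, hbc, hc, rfl⟩ := exists_sorted_triple (hF hA)
        rw [Finset.mem_union, Finset.mem_union]
        by_cases hcm : c ≤ i + 3
        · exact Or.inl (triple_mem_powersetCard ha hab hbc hcm)
        have hb : b ≤ i + 3 := by
          by_contra hb
          exact hi (hS.triple_mem hA hab hbc le_rfl (by omega) (by omega) ha (by omega)
            (by omega))
        by_cases hcm' : c ≤ 2 * i + 3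
        · exact Or.inr (Or.inl (triple_mem_pairsWith (pair_mem_powersetCard ha hab hb)
            (Finset.mem_Icc.2 (by omega))))
        refine Or.inr (Or.inr (triple_mem_pairsWith (Finset.mem_insert.2 ?_)
          (Finset.mem_Icc.2 (by omega))))
        by_cases hb' : b ≤ i + 2
        · exact Or.inr (pair_mem_powersetCard ha hab hb')
        left
        obtain rfl : b = i + 3 := by omega
        obtain rfl : a = 1 := by
          by_contra hne
          exact hT (hS.triple_mem hA hab hbc (by omega) (by omega) (by omega) (by omega)
            (by omega) (by omega))
        rfl
      have h := (Finset.card_le_card hsub).trans ((Finset.card_union_le _ _).trans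
        (Nat.add_le_add_left (Finset.card_union_le _ _) _))
      have h1 := card_pairsWith_le (Finset.powersetCard 2 (Finset.Icc 1 (i + 3)))
        (Finset.Icc (i + 4) (2 * i + 3))
      have h2 := (card_pairsWith_le
        (insert {1, i + 3} (Finset.powersetCard 2 (Finset.Icc 1 (i + 2))))
        (Finset.Icc (2 * i + 4) n)).trans (Nat.mul_le_mul (Finset.card_insert_le _ _)
          (show _ ≤ i by rw [Nat.card_Icc]; omega))
      simp only [Finset.card_powersetCard, Nat.card_Icc, Nat.add_sub_cancel] at h h1 h2
      rw [show 2 * i + 3 + 1 - (i + 4) = i by omega] at h1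
      have h3 := six_mul_choose_three (i + 1)
      have h4 := two_mul_choose_two (i + 2)
      have h5 := two_mul_choose_two (i + 1)
      have h6 := six_mul_choose_three (2 * i + 1)
      -- Six times the slack is `i³ - 6i² - 19i`, which is nonnegative from `i = 9` on but negative
      -- at `i = 8`: this count needs `s ≥ 10`.
      obtain ⟨t, rfl⟩ : ∃ t, i = t + 9 := ⟨i - 9, by omega⟩
      have h7 : 6 * (F.card) ≤ 6 * (2 * (t + 9) + 1 + 2).choose 3 := by
        rw [h6]
        nlinarith [Nat.zero_le (t ^ 3), Nat.zero_le (t ^ 2)]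
      exact Nat.le_of_mul_le_mul_left h7 (by omega)

/-! ### The extremal family and the conclusion -/

theorem familyA_eq_of_le {n s : ℕ} (h : 2 * s + 1 ≤ n) :
    familyA (2 * s + 1) 3 n 3 = kSubsets (2 * s + 1) 3 := by
  ext A
  simp only [familyA, kSubsets, Finset.mem_filter, Finset.mem_powersetCard]
  constructor
  · rintro ⟨⟨-, hA⟩, h3⟩
    exact ⟨Finset.inter_eq_left.1 (Finset.eq_of_subset_of_card_le Finset.inter_subset_left
      (by omega)), hA⟩
  · rintro ⟨hsub, hA⟩
    exact ⟨⟨hsub.trans (Finset.Icc_subset_Icc_right h), hA⟩,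
      by rw [Finset.inter_eq_left.2 hsub, hA]⟩

theorem hasPropertyU_familyA (n s : ℕ) :
    HasPropertyU (familyA (2 * s + 1) 3 n 3) s (2 * s + 1) := by
  intro G hG
  have hsub : Finset.univ.biUnion G ⊆ Finset.Icc 1 (2 * s + 1) := by
    refine Finset.biUnion_subset.2 fun i _ => ?_
    obtain ⟨h1, h2⟩ := Finset.mem_filter.1 (hG i)
    have h3 := (Finset.mem_powersetCard.1 h1).2
    exact Finset.inter_eq_left.1 (Finset.eq_of_subset_of_card_le Finset.inter_subset_left
      (by omega))
  simpa using Finset.card_le_card hsub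

theorem mainTheorem6 (n s : ℕ) (hs : 10 ≤ s) (hn : n ≤ 3 * s) :
    (∀ F : Finset (Finset ℕ), F ⊆ kSubsets n 3 → HasPropertyU F s (2 * s + 1) →
      F.card ≤ (familyA (2 * s + 1) 3 n 3).card ∧
      F.card ≤ Nat.choose (2 * s + 1) 3) ∧
    HasPropertyU (familyA (2 * s + 1) 3 n 3) s (2 * s + 1) ∧
    (2 * s + 1 ≤ n → familyA (2 * s + 1) 3 n 3 = kSubsets (2 * s + 1) 3) := by
  refine ⟨fun F hF hU => ?_, hasPropertyU_familyA n s, familyA_eq_of_le⟩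
  have hle : F.card ≤ (2 * s + 1).choose 3 := by
    obtain ⟨F', h1, h2, h3, h4⟩ := exists_isShifted hF hU
    exact h3 ▸ h4.card_le_choose hs hn h1 h2
  refine ⟨?_, hle⟩
  by_cases h : 2 * s + 1 ≤ n
  · rw [familyA_eq_of_le h, kSubsets, Finset.card_powersetCard, Nat.card_Icc]
    exact hle
  -- For `n < 2s + 1` every triple of `[n]` lies in `[2s+1]`.
  · refine Finset.card_le_card fun A hA => Finset.mem_filter.2 ⟨hF hA, ?_⟩
    obtain ⟨hsub, hcard⟩ := Finset.mem_powersetCard.1 (hF hA)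
    rw [Finset.inter_eq_left.2 (hsub.trans (Finset.Icc_subset_Icc_right (by omega))), hcard]
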